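/- Let $n \ge 1$ and $N = 2^n$. Let $G_2 = \begin{pmatrix} 1 & 0 \\ 1 & 1 \end{pmatrix}$ over $\mathbb{F}_2$ and $G_N = G_2^{\otimes n}$, and let $W$ be a binary-input discrete memoryless channel with positive symmetric capacity $\mathcal{I}(W) > 0$ (the symmetric capacity is the mutual information between a uniform input bit and the output). For a puncturing pattern $P \in \{0,1\}^N$ and $0 \le i \le N-1$, let $W[P]_N^{(i)}$ be the virtual channel with input $u_i$ and output $(y_0^{N-1}, u_0^{i-1})$, where the data bits other than $u_i$ are independent and uniform, $x_0^{N-1} = u_0^{N-1} G_N$, the symbols $y_j$ are conditionally independent given $x_0^{N-1}$, and $y_j$ is the output of $W$ on input $x_j$ if $P(j) = 0$, while $y_j = \star$ (a fixed extra erasure symbol) if $P(j) = 1$. The erasure pattern $E[P] \in \{0,1\}^N$ is defined by $E[P](i) = 1$ if and only if $\mathcal{I}(W[P]_N^{(i)}) = 0$, and $P$ is called symmetric if $E[P] = P$; the same definitions apply to patterns of length $N/2 = 2^{n-1}$ (with $G_1 = (1)$). For $M$ a power of $2$, let $B_M$ be the bit-reversal permutation of $\{0, \dots, M-1\}$, acting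 on vectors of length $M$ by $B_M(A)(i) = A(B_M(i))$. For binary vectors, $A \subseteq B$ means $A \vee B = B$ bitwise. Theorem (recursive characterization of symmetric patterns). Let $P \in \{0,1\}^N$, $\bar P = B_N(P)$, $\bar P_0 = [\bar P(0), \dots, \bar P(N/2-1)]$ and $\bar P_1 = [\bar P(N/2), \dots, \bar P(N-1)]$. Then $P$ is symmetric if and only if $B_{N/2}(\bar P_0)$ and $B_{N/2}(\bar P_1)$ are both symmetric and $\bar P_1 \subseteq \bar P_0$. -/

import Mathlib

namespace PolarPuncturing

open scoped BigOperators

/-! ### Binary vectors and bit reversal -/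

/-- Binary vectors of length `N`; a puncturing pattern `P` punctures position `i` iff `P i = true`. -/
abbrev Pattern (N : ℕ) : Type := Fin N → Bool

/-- The bit-reversal permutation of `{0, …, 2 ^ n - 1}`: write `i` with `n` binary digits, reverse
the order of the digits, and read the result as a number. -/
def bitReversal (n : ℕ) : Equiv.Perm (Fin (2 ^ n)) :=
  (finFunctionFinEquiv (m := 2) (n := n)).symm.trans
    ((Equiv.arrowCongr Fin.revPerm (Equiv.refl (Fin 2))).trans finFunctionFinEquiv)

/-- Action of a permutation on a vector: `φ(A)(i) = A(φ(i))`. -/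
def permute {N : ℕ} (φ : Equiv.Perm (Fin N)) (A : Pattern N) : Pattern N := fun i => A (φ i)

/-- `[A(0), …, A(N/2 - 1)]` for `N = 2 ^ (n + 1)`. -/
def firstHalf {n : ℕ} (A : Pattern (2 ^ (n + 1))) : Pattern (2 ^ n) :=
  fun i => A ⟨i, by have := i.isLt; rw [pow_succ]; omega⟩

/-- `[A(N/2), …, A(N - 1)]` for `N = 2 ^ (n + 1)`. -/
def secondHalf {n : ℕ} (A : Pattern (2 ^ (n + 1))) : Pattern (2 ^ n) :=
  fun i => A ⟨2 ^ n + i, by have := i.isLt; rw [pow_succ]; omega⟩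

/-- Bitwise inclusion `A ⊆ B` of binary vectors: `A ∨ B = B`. -/
def BitIncluded {N : ℕ} (A B : Pattern N) : Prop := (fun i => A i || B i) = B

/-! ### The generator matrix -/

/-- The polar kernel. -/
def kernelMatrix : Matrix (Fin 2) (Fin 2) (ZMod 2) := !![1, 0; 1, 1]

/-- The pair `(a, j)` corresponds to the index `a * 2 ^ n + j`. -/
def blockEquiv (n : ℕ) : Fin 2 × Fin (2 ^ n) ≃ Fin (2 ^ (n + 1)) :=
  finProdFinEquiv.trans (finCongr (pow_succ' 2 n).symm)

/-- The generator matrix of size `N = 2 ^ n`: the `n`-th Kronecker power of the kernel. -/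
def generatorMatrix : (n : ℕ) → Matrix (Fin (2 ^ n)) (Fin (2 ^ n)) (ZMod 2)
  | 0 => 1
  | n + 1 => Matrix.reindex (blockEquiv n) (blockEquiv n)
      (Matrix.kronecker kernelMatrix (generatorMatrix n))

/-! ### Channels -/

/-- A binary-input discrete memoryless channel with output alphabet `Y`: for each input bit `x`, a
discrete probability distribution `W(· | x)` on `Y`. -/
abbrev BDMC (Y : Type*) := ZMod 2 → PMF Y

/-- The symmetric capacity: the mutual information, in bits, between a uniform input bit and the
output,
`I(W) = ∑_y ∑_x (1/2) W(y|x) log₂ (W(y|x) / ((1/2) W(y|0) + (1/2) W(y|1)))`. -/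
noncomputable def symmetricCapacity {Y : Type*} (W : BDMC Y) : ℝ :=
  ∑' y, ∑ x : ZMod 2, (1 / 2 : ℝ) * (W x y).toReal *
    Real.logb 2 ((W x y).toReal / ((1 / 2 : ℝ) * (W 0 y).toReal + (1 / 2 : ℝ) * (W 1 y).toReal))

/-- The series defining the symmetric capacity always converges absolutely. -/
theorem summable_symmetricCapacity {Y : Type*} (W : BDMC Y) :
    Summable fun y => ∑ x : ZMod 2, (1 / 2 : ℝ) * (W x y).toReal *
      Real.logb 2
        ((W x y).toReal / ((1 / 2 : ℝ) * (W 0 y).toReal + (1 / 2 : ℝ) * (W 1 y).toReal)) := by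
  have hs : ∀ x : ZMod 2, Summable fun y => (W x y).toReal :=
    fun x => ENNReal.summable_toReal (W x).tsum_coe_ne_top
  have key : ∀ a m : ℝ, 0 ≤ a → 0 ≤ m → a ≤ 2 * m →
      |a * Real.log (a / m)| ≤ a + m := by
    intro a m ha hm ham
    rcases ha.eq_or_lt with rfl | ha
    · simpa using hm
    have hm' : 0 < m := by linarith
    have h1 : Real.log (a / m) ≤ 1 := by
      have h2 : a / m ≤ 2 := (div_le_iff₀ hm').2 ham
      have h3 := Real.log_le_sub_one_of_pos (div_pos ha hm')
      linarith
    have h4 : 1 - m / a ≤ Real.log (a / m) := by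
      have := Real.one_sub_inv_le_log_of_pos (div_pos ha hm')
      rwa [inv_div] at this
    have h5 : a * (1 - m / a) = a - m := by field_simp
    have h6 := mul_le_mul_of_nonneg_left h4 ha.le
    have h7 := mul_le_mul_of_nonneg_left h1 ha.le
    rw [abs_le]
    constructor <;> linarith
  refine summable_sum fun x _ => ?_
  refine Summable.of_norm_bounded
    (g := fun y => (1 / 2 / Real.log 2) * ((W x y).toReal +
      ((1 / 2 : ℝ) * (W 0 y).toReal + (1 / 2 : ℝ) * (W 1 y).toReal))) ?_ ?_
  · exact ((hs x).add (((hs 0).mul_left _).add ((hs 1).mul_left _))).mul_left _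
  · intro y
    have hl : 0 < Real.log 2 := Real.log_pos (by norm_num)
    have h0 : 0 ≤ (W 0 y).toReal := ENNReal.toReal_nonneg
    have h1 : 0 ≤ (W 1 y).toReal := ENNReal.toReal_nonneg
    have hx : (W x y).toReal ≤
        2 * ((1 / 2 : ℝ) * (W 0 y).toReal + (1 / 2 : ℝ) * (W 1 y).toReal) := by
      fin_cases x
      · change (W 0 y).toReal ≤ _
        linarith
      · change (W 1 y).toReal ≤ _
        linarith
    have hk := key _ _ ENNReal.toReal_nonneg (by positivity) hx
    have he : ∀ a b : ℝ, (1 / 2 : ℝ) * a * Real.logb 2 b =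
        (1 / 2 / Real.log 2) * (a * Real.log b) := by
      intro a b
      rw [Real.logb]
      ring
    rw [he, Real.norm_eq_abs, abs_mul, abs_of_pos (by positivity)]
    exact mul_le_mul_of_nonneg_left hk (by positivity)

/-- The law of `N` independent outputs, the `j`-th one distributed according to `p j`. -/
noncomputable def productLaw {Z : Type*} {N : ℕ} (p : Fin N → PMF Z) : PMF (Fin N → Z) :=
  ⟨fun z => ∏ j, p j (z j), by
    have h : ∑' z : Fin N → Z, ∏ j, p j (z j) = 1 := by
      induction N with
      | zero => simp
      | succ N ih =>
        rw [← (Fin.consEquiv fun _ : Fin (N + 1) => Z).tsum_eq, ENNReal.tsum_prod']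
        simp only [Fin.consEquiv, Equiv.coe_fn_mk, Fin.prod_univ_succ, Fin.cons_zero,
          Fin.cons_succ, ENNReal.tsum_mul_left]
        simp only [ih fun j => p j.succ, mul_one, PMF.tsum_coe]
    exact h ▸ ENNReal.summable.hasSum⟩

/-- The channel seen by position `j` of the codeword. The output alphabet is extended by the symbol
`⋆ = none`; a punctured position always outputs `⋆`, the others use `W`. -/
noncomputable def puncturedChannel {Y : Type*} (W : BDMC Y) {N : ℕ} (P : Pattern N) (j : Fin N) :
    BDMC (Option Y) :=
  fun x => if P j = true then PMF.pure none else (W x).map some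

/-- The virtual channel `W[P]_N^{(i)}` with input `u_i` and output `(y[P]_0^{N-1}, u_0^{i-1})`,
for `N = 2 ^ n`: all data bits other than `u_i` are uniform and independent, the codeword
`x = u · G_N` is sent position by position through the punctured channels, and the receiver sees
all `N` outputs together with the data bits preceding `u_i`. -/
noncomputable def virtualChannel {Y : Type*} (W : BDMC Y) {n : ℕ} (P : Pattern (2 ^ n))
    (i : Fin (2 ^ n)) : BDMC ((Fin (2 ^ n) → Option Y) × (Fin i → ZMod 2)) :=
  fun b =>
    (PMF.uniformOfFintype (Fin (2 ^ n) → ZMod 2)).bind fun v =>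
      let u : Fin (2 ^ n) → ZMod 2 := Function.update v i b
      let x : Fin (2 ^ n) → ZMod 2 := Matrix.vecMul u (generatorMatrix n)
      (productLaw fun j => puncturedChannel W P j (x j)).map fun y =>
        (y, fun k : Fin i => u ⟨k, k.isLt.trans i.isLt⟩)

/-! ### Erasure patterns and symmetric patterns -/

open Classical in
/-- The data bit erasure pattern `E[P]`: `E[P](i) = 1` iff the virtual channel `W[P]_N^{(i)}` has
symmetric capacity zero. -/
noncomputable def erasurePattern {Y : Type*} (W : BDMC Y) {n : ℕ} (P : Pattern (2 ^ n)) :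
    Pattern (2 ^ n) :=
  fun i => decide (symmetricCapacity (virtualChannel W P i) = 0)

/-- A puncturing pattern is symmetric if it equals its erasure pattern. -/
def IsSymmetricPattern {Y : Type*} (W : BDMC Y) {n : ℕ} (P : Pattern (2 ^ n)) : Prop :=
  erasurePattern W P = P

end PolarPuncturing

open PolarPuncturing

/-!
The symmetric capacity is a sum of nonnegative Kullback-Leibler terms comparing `W 0 y` and `W 1 y`
with their average, so it vanishes iff both inputs have the same output law.
For a virtual channel this turns into linear algebra: `u_i` is erased iff some data vector with
first nonzero bit at `i` has a codeword supported on the punctured positions. Given such a vector,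
translating the uniform data by it exchanges the two inputs. Otherwise `u_i` is a linear function of
the earlier bits and of the unpunctured code symbols; since `W 0 ≠ W 1`, the sign of each such
symbol is the expectation of a test function of the corresponding output, and the product of these
test functions with the sign of the linear form in the earlier bits distinguishes the two inputs.

In the Kronecker product `G_{2N} = G_N ⊗ G_2` the second factor acts on the least significant digit.
If `w₀` and `w₁` are the data bits at the even and odd positions, then `(w₀ + w₁) G_N` and `w₁ G_N`
are the code symbols there. With `P₀` and `P₁` the even and odd parts of `P`, it follows that `E[P]`
has even part `E[P₀] ∨ E[P₁]` and odd part `E[P₀] ∧ E[P₁]`. As `E` is monotone, `E[P] = P` iff `E`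
fixes `P₀` and `P₁` and `P₁ ≤ P₀`. Bit reversal turns the halves of `Pbar` into `P₀` and `P₁`.
-/

namespace PolarPuncturing

open Matrix

/-! ### Vanishing of the symmetric capacity -/

theorem sum_zmod_two {M : Type*} [AddCommMonoid M] (f : ZMod 2 → M) : ∑ x, f x = f 0 + f 1 :=
  Fin.sum_univ_two f

theorem zmod_two_eq_zero_or_one (x : ZMod 2) : x = 0 ∨ x = 1 := by
  revert x
  decide

/-- The contribution to the symmetric capacity of an output symbol which has probability `a` under
input `0` and `b` under input `1`. -/
noncomputable def capacityTerm (a b : ℝ) : ℝ :=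
  1 / 2 * a * Real.logb 2 (a / (1 / 2 * a + 1 / 2 * b)) +
    1 / 2 * b * Real.logb 2 (b / (1 / 2 * a + 1 / 2 * b))

open InformationTheory in
theorem capacityTerm_eq_klFun {a b m : ℝ} (hm : m ≠ 0) (hab : a + b = 2 * m) :
    capacityTerm a b = m / (2 * Real.log 2) * (klFun (a / m) + klFun (b / m)) := by
  have hlog : Real.log 2 ≠ 0 := (Real.log_pos one_lt_two).ne'
  have hmean : 1 / 2 * a + 1 / 2 * b = m := by linarith
  simp only [capacityTerm, hmean, klFun_apply, Real.logb]
  field_simp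
  linear_combination hab

open InformationTheory in
theorem capacityTerm_nonneg {a b : ℝ} (ha : 0 ≤ a) (hb : 0 ≤ b) : 0 ≤ capacityTerm a b := by
  rcases (add_nonneg ha hb).eq_or_lt with hab | hab
  · obtain ⟨rfl, rfl⟩ := (add_eq_zero_iff_of_nonneg ha hb).1 hab.symm
    simp [capacityTerm]
  · have hm : 0 < (a + b) / 2 := half_pos hab
    rw [capacityTerm_eq_klFun hm.ne' (by ring)]
    have hka := klFun_nonneg (div_nonneg ha hm.le)
    have hkb := klFun_nonneg (div_nonneg hb hm.le)
    positivity

open InformationTheory in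
theorem capacityTerm_eq_zero_iff {a b : ℝ} (ha : 0 ≤ a) (hb : 0 ≤ b) :
    capacityTerm a b = 0 ↔ a = b := by
  rcases (add_nonneg ha hb).eq_or_lt with hab | hab
  · obtain ⟨rfl, rfl⟩ := (add_eq_zero_iff_of_nonneg ha hb).1 hab.symm
    simp [capacityTerm]
  · have hm : 0 < (a + b) / 2 := half_pos hab
    have ha' := div_nonneg ha hm.le
    have hb' := div_nonneg hb hm.le
    have hc : (a + b) / 2 / (2 * Real.log 2) ≠ 0 :=
      div_ne_zero hm.ne' (mul_ne_zero two_ne_zero (Real.log_pos one_lt_two).ne')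
    rw [capacityTerm_eq_klFun hm.ne' (by ring), mul_eq_zero_iff_left hc,
      add_eq_zero_iff_of_nonneg (klFun_nonneg ha') (klFun_nonneg hb'), klFun_eq_zero_iff ha',
      klFun_eq_zero_iff hb', div_eq_one_iff_eq hm.ne', div_eq_one_iff_eq hm.ne']
    constructor
    · rintro ⟨h, h'⟩
      exact h.trans h'.symm
    · rintro rfl
      constructor <;> ring

theorem symmetricCapacity_eq_zero_iff {Y : Type*} (W : BDMC Y) :
    symmetricCapacity W = 0 ↔ W 0 = W 1 := by
  have hsum := (summable_symmetricCapacity W).hasSum_iff (a := 0)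
  simp only [sum_zmod_two] at hsum
  have hnonneg x y : 0 ≤ (W x y).toReal := ENNReal.toReal_nonneg
  simp only [symmetricCapacity, sum_zmod_two]
  refine hsum.symm.trans ((hasSum_zero_iff_of_nonneg fun y =>
    capacityTerm_nonneg (hnonneg 0 y) (hnonneg 1 y)).trans ?_)
  rw [funext_iff, DFunLike.ext_iff]
  refine forall_congr' fun y => (capacityTerm_eq_zero_iff (hnonneg 0 y) (hnonneg 1 y)).trans ?_
  exact ENNReal.toReal_eq_toReal_iff' (PMF.apply_ne_top _ _) (PMF.apply_ne_top _ _)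

/-! ### Erased positions of a linear encoder -/

/-- The first nonzero bit of the data vector `w` is at position `i`. -/
def IsLeading {N : ℕ} (i : Fin N) (w : Fin N → ZMod 2) : Prop :=
  (∀ k < i, w k = 0) ∧ w i = 1

/-- The word `x` vanishes at all positions that are not punctured by `P`. -/
def VanishesOff {N : ℕ} (P : Pattern N) (x : Fin N → ZMod 2) : Prop :=
  ∀ j, P j = false → x j = 0

/-- Position `i` is erased by the pattern `P` under the linear encoder `G`: the data bit `i` can be
flipped, together with some later ones, without changing the unpunctured code symbols. -/
def IsErased {N M : ℕ} (G : Matrix (Fin N) (Fin M) (ZMod 2)) (P : Pattern M) (i : Fin N) : Prop :=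
  ∃ w, IsLeading i w ∧ VanishesOff P (w ᵥ* G)

theorem IsErased.mono {N M : ℕ} {G : Matrix (Fin N) (Fin M) (ZMod 2)} {P Q : Pattern M}
    (hPQ : P ≤ Q) {i : Fin N} (hP : IsErased G P i) : IsErased G Q i := by
  obtain ⟨w, hw, hoff⟩ := hP
  refine ⟨w, hw, fun j hj => hoff j ?_⟩
  exact le_bot_iff.1 ((hPQ j).trans_eq hj)

theorem exists_dotProduct_eq_of_not_isErased {N M : ℕ} {G : Matrix (Fin N) (Fin M) (ZMod 2)}
    {P : Pattern M} {i : Fin N} (h : ¬ IsErased G P i) :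
    ∃ (c : Fin i → ZMod 2) (d : Fin M → ZMod 2), (∀ j, P j = true → d j = 0) ∧
      ∀ u : Fin N → ZMod 2,
        u i = (c ⬝ᵥ fun k => u ⟨k, k.isLt.trans i.isLt⟩) + d ⬝ᵥ (u ᵥ* G) := by
  let observed : Fin i ⊕ Fin M → (Fin N → ZMod 2) →ₗ[ZMod 2] ZMod 2 :=
    Sum.elim (fun k => LinearMap.proj ⟨k, k.isLt.trans i.isLt⟩)
      (fun j => if P j then 0 else LinearMap.proj j ∘ₗ G.vecMulLinear)
  have hspan : LinearMap.proj i ∈ Submodule.span (ZMod 2) (Set.range observed) := by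
    refine mem_span_of_iInf_ker_le_ker fun u hu => ?_
    simp only [Submodule.mem_iInf, LinearMap.mem_ker] at hu
    refine (zmod_two_eq_zero_or_one (u i)).resolve_right fun hui =>
      h ⟨u, ⟨fun k hk => hu (Sum.inl ⟨k, hk⟩), hui⟩, fun j hj => ?_⟩
    simpa [observed, hj] using hu (Sum.inr j)
  obtain ⟨c, hc⟩ := (Submodule.mem_span_range_iff_exists_fun (ZMod 2)).1 hspan
  refine ⟨fun k => c (Sum.inl k), fun j => if P j then 0 else c (Sum.inr j),
    fun j hj => if_pos hj, fun u => ?_⟩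
  rw [← LinearMap.proj_apply (R := ZMod 2) i u, ← hc, Fintype.sum_sum_type, LinearMap.add_apply,
    LinearMap.sum_apply, LinearMap.sum_apply]
  refine congrArg₂ (· + ·) rfl (Finset.sum_congr rfl fun j _ => ?_)
  cases hj : P j <;> simp [observed, hj]

/-! ### Virtual channels and erased positions -/

theorem bind_uniformOfFintype_add_right {G α : Type*} [AddGroup G] [Fintype G] (w : G)
    (f : G → PMF α) :
    ((PMF.uniformOfFintype G).bind fun v => f (v + w)) = (PMF.uniformOfFintype G).bind f := by
  ext a
  simp only [PMF.bind_apply, PMF.uniformOfFintype_apply]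
  exact (Equiv.addRight w).tsum_eq fun v => (Fintype.card G : ENNReal)⁻¹ * f v a

theorem virtualChannel_zero_eq_one_of_isErased {Y : Type*} (W : BDMC Y) {n : ℕ}
    {P : Pattern (2 ^ n)} {i : Fin (2 ^ n)} (h : IsErased (generatorMatrix n) P i) :
    virtualChannel W P i 0 = virtualChannel W P i 1 := by
  obtain ⟨w, ⟨hlt, hi⟩, hoff⟩ := h
  have hupdate v : Function.update (v + w) i 1 = Function.update v i 0 + w := by
    rw [← zero_add (1 : ZMod 2), ← hi, Function.update_add, Function.update_eq_self]
  have hpunctured x j : puncturedChannel W P j ((x + w ᵥ* generatorMatrix n) j) =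
      puncturedChannel W P j (x j) := by
    cases hj : P j
    · rw [Pi.add_apply, hoff j hj, add_zero]
    · simp only [puncturedChannel, hj, if_true]
  have hpast u (k : Fin i) : (u + w) ⟨k, k.isLt.trans i.isLt⟩ = u ⟨k, k.isLt.trans i.isLt⟩ := by
    rw [Pi.add_apply, hlt _ k.isLt, add_zero]
  refine Eq.trans ?_ (bind_uniformOfFintype_add_right w _)
  simp only [hupdate, add_vecMul, hpunctured, hpast]
  rfl

/-- The expectation of a finitely supported function of an outcome distributed according to `p`. -/
noncomputable def mean {α : Type*} (p : PMF α) (g : α →₀ ℝ) : ℝ :=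
  g.sum fun a r => r * (p a).toReal

theorem mean_single {α : Type*} (p : PMF α) (a : α) (r : ℝ) :
    mean p (Finsupp.single a r) = r * (p a).toReal :=
  Finsupp.sum_single_index (zero_mul _)

theorem mean_add {α : Type*} (p : PMF α) (g h : α →₀ ℝ) : mean p (g + h) = mean p g + mean p h :=
  Finsupp.sum_add_index' (fun _ => zero_mul _) fun _ _ _ => add_mul _ _ _

theorem exists_toReal_lt_of_ne {α : Type*} {p q : PMF α} (h : p ≠ q) :
    ∃ a, (p a).toReal < (q a).toReal := by
  obtain ⟨a, ha⟩ : ∃ a, p a < q a := by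
    by_contra! hle
    obtain ⟨a, ha⟩ := DFunLike.ne_iff.1 h
    have := ENNReal.tsum_lt_tsum q.tsum_coe_ne_top hle ((hle a).lt_of_ne' ha)
    simp [PMF.tsum_coe] at this
  exact ⟨a, (ENNReal.toReal_lt_toReal (PMF.apply_ne_top _ _) (PMF.apply_ne_top _ _)).2 ha⟩

theorem exists_mean_eq {Y : Type*} {W : BDMC Y} (hW : W 0 ≠ W 1) (f : ZMod 2 → ℝ) :
    ∃ g : Y →₀ ℝ, ∀ x, mean (W x) g = f x := by
  obtain ⟨y, hy⟩ := exists_toReal_lt_of_ne hW.symm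
  obtain ⟨z, hz⟩ := exists_toReal_lt_of_ne hW
  set D := (W 0 y).toReal * (W 1 z).toReal - (W 1 y).toReal * (W 0 z).toReal
  have hD : D ≠ 0 := (sub_pos.2 (mul_lt_mul'' hy hz ENNReal.toReal_nonneg
    ENNReal.toReal_nonneg)).ne'
  -- Cramer's rule for the two equations `mean (W 0) g = f 0` and `mean (W 1) g = f 1`.
  refine ⟨Finsupp.single y ((f 0 * (W 1 z).toReal - f 1 * (W 0 z).toReal) / D) +
    Finsupp.single z ((f 1 * (W 0 y).toReal - f 0 * (W 1 y).toReal) / D), fun x => ?_⟩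
  rw [mean_add, mean_single, mean_single]
  rcases zmod_two_eq_zero_or_one x with rfl | rfl <;> field_simp <;> ring

theorem map_apply_of_injective {α β : Type*} {f : α → β} (hf : Function.Injective f) (p : PMF α)
    (a : α) : p.map f (f a) = p a := by
  classical
  rw [PMF.map_apply, tsum_eq_single a fun a' ha' => if_neg (hf.ne ha'.symm), if_pos rfl]

theorem map_injective {α β : Type*} {f : α → β} (hf : Function.Injective f) :
    Function.Injective (PMF.map f) := by
  intro p q h
  ext a
  rw [← map_apply_of_injective hf p, h, map_apply_of_injective hf q]

theorem exists_mean_puncturedChannel_eq {Y : Type*} {W : BDMC Y} (hW : W 0 ≠ W 1) {N : ℕ}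
    {P : Pattern N} {j : Fin N} {f : ZMod 2 → ℝ} (hf : P j = true → f 1 = f 0) :
    ∃ g : Option Y →₀ ℝ, ∀ x, mean (puncturedChannel W P j x) g = f x := by
  unfold puncturedChannel
  cases hj : P j
  · have hsome := (map_injective (Option.some_injective Y)).ne hW
    simpa using exists_mean_eq (W := fun x => (W x).map some) hsome f
  · refine ⟨Finsupp.single none (f 0), fun x => ?_⟩
    rcases zmod_two_eq_zero_or_one x with rfl | rfl <;> simp [mean_single, hf hj]

theorem sum_prod_mul_productLaw {Z : Type*} {N : ℕ} (p : Fin N → PMF Z) (g : Fin N → Z →₀ ℝ) :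
    ∑ z ∈ Fintype.piFinset fun j => (g j).support, (∏ j, g j (z j)) * (productLaw p z).toReal =
      ∏ j, mean (p j) (g j) := by
  simp only [mean, Finsupp.sum, Finset.prod_univ_sum, Finset.prod_mul_distrib]
  refine Finset.sum_congr rfl fun z _ => ?_
  rw [← ENNReal.toReal_prod]
  rfl

theorem map_prodMk_apply {α β : Type*} [DecidableEq β] (p : PMF α) (b c : β) (a : α) :
    p.map (fun a => (a, c)) (a, b) = if b = c then p a else 0 := by
  split_ifs with h
  · subst h
    exact map_apply_of_injective (Prod.mk_left_injective b) p a
  · simp [PMF.map_apply, h]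

theorem toReal_bind_uniformOfFintype_apply {ι α : Type*} [Fintype ι] [Nonempty ι]
    (f : ι → PMF α) (a : α) :
    ((PMF.uniformOfFintype ι).bind f a).toReal = (Fintype.card ι : ℝ)⁻¹ * ∑ v, (f v a).toReal := by
  simp only [PMF.bind_apply, PMF.uniformOfFintype_apply, tsum_fintype, ← Finset.mul_sum,
    ENNReal.toReal_mul, ENNReal.toReal_inv, ENNReal.toReal_natCast]
  rw [ENNReal.toReal_sum fun v _ => PMF.apply_ne_top _ _]

theorem sum_mul_virtualChannel {Y : Type*} (W : BDMC Y) {n : ℕ} (P : Pattern (2 ^ n))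
    (i : Fin (2 ^ n)) (b : ZMod 2) (φ : (Fin i → ZMod 2) → ℝ)
    (g : Fin (2 ^ n) → Option Y →₀ ℝ) :
    ∑ s, ∑ y ∈ Fintype.piFinset fun j => (g j).support,
        φ s * ((∏ j, g j (y j)) * (virtualChannel W P i b (y, s)).toReal) =
      (Fintype.card (Fin (2 ^ n) → ZMod 2) : ℝ)⁻¹ * ∑ v : Fin (2 ^ n) → ZMod 2,
        φ (fun k => Function.update v i b ⟨k, k.isLt.trans i.isLt⟩) * ∏ j,
          mean (puncturedChannel W P j ((Function.update v i b ᵥ* generatorMatrix n) j)) (g j) := by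
  classical
  simp only [virtualChannel, toReal_bind_uniformOfFintype_apply, map_prodMk_apply,
    ← sum_prod_mul_productLaw, Finset.mul_sum]
  simp only [apply_ite ENNReal.toReal, ENNReal.toReal_zero, mul_ite, mul_zero]
  rw [Finset.sum_comm_cycle]
  refine Finset.sum_congr rfl fun v _ => ?_
  rw [Finset.sum_comm]
  refine Finset.sum_congr rfl fun y _ => ?_
  simp only [Finset.sum_ite_eq', Finset.mem_univ, if_true]
  ring

theorem addChar_sum {A M ι : Type*} [AddCommMonoid A] [CommMonoid M] (ψ : AddChar A M)
    (s : Finset ι) (f : ι → A) : ψ (∑ j ∈ s, f j) = ∏ j ∈ s, ψ (f j) :=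
  map_prod ψ.toMonoidHom (fun j => Multiplicative.ofAdd (f j)) s

/-- The nontrivial real character of `ZMod 2`. -/
noncomputable def signChar : AddChar (ZMod 2) ℝ := AddChar.zmodChar 2 (ζ := -1) (by norm_num)

theorem virtualChannel_zero_ne_one_of_not_isErased {Y : Type*} {W : BDMC Y} (hW : W 0 ≠ W 1)
    {n : ℕ} {P : Pattern (2 ^ n)} {i : Fin (2 ^ n)} (h : ¬ IsErased (generatorMatrix n) P i) :
    virtualChannel W P i 0 ≠ virtualChannel W P i 1 := by
  obtain ⟨c, d, hd, hcd⟩ := exists_dotProduct_eq_of_not_isErased h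
  have htest j := exists_mean_puncturedChannel_eq hW (P := P) (j := j)
    (f := fun x => signChar (d j * x)) fun hj => by simp [hd j hj]
  choose g hg using htest
  have hmean b : ∑ s, ∑ y ∈ Fintype.piFinset fun j => (g j).support,
      signChar (c ⬝ᵥ s) * ((∏ j, g j (y j)) * (virtualChannel W P i b (y, s)).toReal) =
        signChar b := by
    have hdecode (u : Fin (2 ^ n) → ZMod 2) :
        signChar (c ⬝ᵥ fun k => u ⟨k, k.isLt.trans i.isLt⟩) *
          ∏ j, signChar (d j * (u ᵥ* generatorMatrix n) j) = signChar (u i) := by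
      rw [← addChar_sum, ← AddChar.map_add_eq_mul, hcd u]
      rfl
    rw [sum_mul_virtualChannel W P i b fun s => signChar (c ⬝ᵥ s)]
    simp [hg, hdecode]
  intro heq
  have hsign : signChar 0 = signChar 1 := by rw [← hmean 0, heq, hmean 1]
  norm_num [signChar, AddChar.zmodChar_apply, ZMod.val_one] at hsign

theorem erasurePattern_eq_true_iff {Y : Type*} {W : BDMC Y} (hW : 0 < symmetricCapacity W) {n : ℕ}
    (P : Pattern (2 ^ n)) (i : Fin (2 ^ n)) :
    erasurePattern W P i = true ↔ IsErased (generatorMatrix n) P i := by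
  have hne : W 0 ≠ W 1 := (symmetricCapacity_eq_zero_iff W).not.1 hW.ne'
  rw [erasurePattern, decide_eq_true_iff, symmetricCapacity_eq_zero_iff]
  refine ⟨fun h => ?_, virtualChannel_zero_eq_one_of_isErased W⟩
  by_contra hi
  exact virtualChannel_zero_ne_one_of_not_isErased hne hi h

theorem erasurePattern_mono {Y : Type*} {W : BDMC Y} (hW : 0 < symmetricCapacity W) (n : ℕ) :
    Monotone (erasurePattern W : Pattern (2 ^ n) → Pattern (2 ^ n)) := by
  intro P Q hPQ i
  rw [Bool.le_iff_imp, erasurePattern_eq_true_iff hW, erasurePattern_eq_true_iff hW]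
  exact IsErased.mono hPQ

/-! ### Recursion on the least significant digit -/

/-- The pair `(i, b)` corresponds to the index `b + 2 * i`: in contrast to `blockEquiv`, the bit `b`
is the least significant digit. -/
def interleaveEquiv (n : ℕ) : Fin (2 ^ n) × Fin 2 ≃ Fin (2 ^ (n + 1)) :=
  finProdFinEquiv.trans (finCongr (pow_succ 2 n).symm)

theorem interleaveEquiv_val {n : ℕ} (i : Fin (2 ^ n)) (b : Fin 2) :
    (interleaveEquiv n (i, b) : ℕ) = b + 2 * i :=
  rfl

theorem blockEquiv_val {n : ℕ} (a : Fin 2) (i : Fin (2 ^ n)) :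
    (blockEquiv n (a, i) : ℕ) = i + 2 ^ n * a :=
  rfl

theorem interleaveEquiv_blockEquiv {n : ℕ} (a b : Fin 2) (i : Fin (2 ^ n)) :
    interleaveEquiv (n + 1) (blockEquiv n (a, i), b) =
      blockEquiv (n + 1) (a, interleaveEquiv n (i, b)) := by
  ext
  simp only [interleaveEquiv_val, blockEquiv_val]
  ring

theorem generatorMatrix_succ_blockEquiv {n : ℕ} (a b : Fin 2) (i j : Fin (2 ^ n)) :
    generatorMatrix (n + 1) (blockEquiv n (a, i)) (blockEquiv n (b, j)) =
      kernelMatrix a b * generatorMatrix n i j := by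
  simp [generatorMatrix]

theorem generatorMatrix_succ_interleaveEquiv {n : ℕ} (i j : Fin (2 ^ n)) (a b : Fin 2) :
    generatorMatrix (n + 1) (interleaveEquiv n (i, a)) (interleaveEquiv n (j, b)) =
      generatorMatrix n i j * kernelMatrix a b := by
  induction n with
  | zero =>
    have hzero (k : Fin (2 ^ 0)) (c : Fin 2) : interleaveEquiv 0 (k, c) = blockEquiv 0 (c, k) := by
      ext
      simp only [interleaveEquiv_val, blockEquiv_val]
      omega
    rw [hzero, hzero, generatorMatrix_succ_blockEquiv, mul_comm]
  | succ n ih =>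
    obtain ⟨⟨c, i⟩, rfl⟩ := (blockEquiv n).surjective i
    obtain ⟨⟨d, j⟩, rfl⟩ := (blockEquiv n).surjective j
    rw [interleaveEquiv_blockEquiv, interleaveEquiv_blockEquiv, generatorMatrix_succ_blockEquiv, ih,
      generatorMatrix_succ_blockEquiv, mul_assoc]

/-- The entries of `A` at the even (`b = 0`) or odd (`b = 1`) indices. -/
def parityPart {α : Type*} {n : ℕ} (b : Fin 2) (A : Fin (2 ^ (n + 1)) → α) : Fin (2 ^ n) → α :=
  fun i => A (interleaveEquiv n (i, b))

theorem forall_fin_two_pow_succ_iff {n : ℕ} {p : Fin (2 ^ (n + 1)) → Prop} :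
    (∀ j, p j) ↔
      (∀ i, p (interleaveEquiv n (i, 0))) ∧ ∀ i, p (interleaveEquiv n (i, 1)) := by
  rw [← (interleaveEquiv n).forall_congr_right, Prod.forall]
  simp only [Fin.forall_fin_two, forall_and]

theorem ext_parityPart_iff {α : Type*} {n : ℕ} {A B : Fin (2 ^ (n + 1)) → α} :
    A = B ↔ parityPart 0 A = parityPart 0 B ∧ parityPart 1 A = parityPart 1 B := by
  simp only [funext_iff]
  exact forall_fin_two_pow_succ_iff

theorem exists_parityPart_eq {α : Type*} {n : ℕ} (A₀ A₁ : Fin (2 ^ n) → α) :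
    ∃ A, parityPart 0 A = A₀ ∧ parityPart 1 A = A₁ :=
  ⟨fun j => ![A₀, A₁] ((interleaveEquiv n).symm j).2 ((interleaveEquiv n).symm j).1,
    by ext; simp [parityPart], by ext; simp [parityPart]⟩

theorem parityPart_vecMul_generatorMatrix {n : ℕ} (w : Fin (2 ^ (n + 1)) → ZMod 2) (b : Fin 2) :
    parityPart b (w ᵥ* generatorMatrix (n + 1)) =
      (kernelMatrix 0 b • parityPart 0 w + kernelMatrix 1 b • parityPart 1 w) ᵥ*
        generatorMatrix n := by
  ext j
  simp only [parityPart, vecMul, dotProduct, Pi.add_apply, Pi.smul_apply, smul_eq_mul]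
  rw [← (interleaveEquiv n).sum_comp, Fintype.sum_prod_type]
  simp only [Fin.sum_univ_two, generatorMatrix_succ_interleaveEquiv]
  refine Finset.sum_congr rfl fun i _ => ?_
  ring

theorem parityPart_zero_vecMul_generatorMatrix {n : ℕ} (w : Fin (2 ^ (n + 1)) → ZMod 2) :
    parityPart 0 (w ᵥ* generatorMatrix (n + 1)) =
      (parityPart 0 w + parityPart 1 w) ᵥ* generatorMatrix n := by
  simp [parityPart_vecMul_generatorMatrix, kernelMatrix]

theorem parityPart_one_vecMul_generatorMatrix {n : ℕ} (w : Fin (2 ^ (n + 1)) → ZMod 2) :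
    parityPart 1 (w ᵥ* generatorMatrix (n + 1)) = parityPart 1 w ᵥ* generatorMatrix n := by
  simp [parityPart_vecMul_generatorMatrix, kernelMatrix]

theorem vanishesOff_iff_parityPart {n : ℕ} {P : Pattern (2 ^ (n + 1))}
    {x : Fin (2 ^ (n + 1)) → ZMod 2} :
    VanishesOff P x ↔ VanishesOff (parityPart 0 P) (parityPart 0 x) ∧
      VanishesOff (parityPart 1 P) (parityPart 1 x) :=
  forall_fin_two_pow_succ_iff

theorem vanishesOff_vecMul_generatorMatrix_iff {n : ℕ} {P : Pattern (2 ^ (n + 1))}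
    {w : Fin (2 ^ (n + 1)) → ZMod 2} :
    VanishesOff P (w ᵥ* generatorMatrix (n + 1)) ↔
      VanishesOff (parityPart 0 P) ((parityPart 0 w + parityPart 1 w) ᵥ* generatorMatrix n) ∧
      VanishesOff (parityPart 1 P) (parityPart 1 w ᵥ* generatorMatrix n) := by
  rw [vanishesOff_iff_parityPart, parityPart_zero_vecMul_generatorMatrix,
    parityPart_one_vecMul_generatorMatrix]

theorem isLeading_interleaveEquiv_zero_iff {n : ℕ} {i : Fin (2 ^ n)}
    {w : Fin (2 ^ (n + 1)) → ZMod 2} :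
    IsLeading (interleaveEquiv n (i, 0)) w ↔
      IsLeading i (parityPart 0 w) ∧ ∀ k < i, parityPart 1 w k = 0 := by
  have hlt (k : Fin (2 ^ n)) (c : Fin 2) :
      interleaveEquiv n (k, c) < interleaveEquiv n (i, 0) ↔ k < i := by
    simp only [Fin.lt_def, interleaveEquiv_val, Fin.val_zero]
    omega
  simp only [IsLeading, forall_fin_two_pow_succ_iff, hlt, parityPart]
  tauto

theorem isLeading_interleaveEquiv_one_iff {n : ℕ} {i : Fin (2 ^ n)}
    {w : Fin (2 ^ (n + 1)) → ZMod 2} :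
    IsLeading (interleaveEquiv n (i, 1)) w ↔
      (∀ k ≤ i, parityPart 0 w k = 0) ∧ IsLeading i (parityPart 1 w) := by
  have hlt_zero (k : Fin (2 ^ n)) :
      interleaveEquiv n (k, 0) < interleaveEquiv n (i, 1) ↔ k ≤ i := by
    simp only [Fin.lt_def, Fin.le_def, interleaveEquiv_val, Fin.val_zero, Fin.val_one]
    omega
  have hlt_one (k : Fin (2 ^ n)) :
      interleaveEquiv n (k, 1) < interleaveEquiv n (i, 1) ↔ k < i := by
    simp only [Fin.lt_def, interleaveEquiv_val, Fin.val_one]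
    omega
  simp only [IsLeading, forall_fin_two_pow_succ_iff, hlt_zero, hlt_one, parityPart]
  tauto

theorem isErased_interleaveEquiv_zero_iff {n : ℕ} {P : Pattern (2 ^ (n + 1))} {i : Fin (2 ^ n)} :
    IsErased (generatorMatrix (n + 1)) P (interleaveEquiv n (i, 0)) ↔
      IsErased (generatorMatrix n) (parityPart 0 P) i ∨
        IsErased (generatorMatrix n) (parityPart 1 P) i := by
  simp only [IsErased, isLeading_interleaveEquiv_zero_iff, vanishesOff_vecMul_generatorMatrix_iff]
  constructor
  · rintro ⟨w, ⟨⟨hlt₀, hi₀⟩, hlt₁⟩, hoff₀, hoff₁⟩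
    rcases zmod_two_eq_zero_or_one (parityPart 1 w i) with hi₁ | hi₁
    · refine Or.inl ⟨_, ⟨fun k hk => ?_, ?_⟩, hoff₀⟩
      · rw [Pi.add_apply, hlt₀ k hk, hlt₁ k hk, add_zero]
      · rw [Pi.add_apply, hi₀, hi₁, add_zero]
    · exact Or.inr ⟨_, ⟨hlt₁, hi₁⟩, hoff₁⟩
  · rintro (⟨w, hw, hoff⟩ | ⟨w, hw, hoff⟩)
    · obtain ⟨v, hv₀, hv₁⟩ := exists_parityPart_eq w 0
      refine ⟨v, ?_, ?_⟩
      · exact ⟨by rwa [hv₀], fun k _ => by rw [hv₁, Pi.zero_apply]⟩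
      · rw [hv₀, hv₁, add_zero, zero_vecMul]
        exact ⟨hoff, fun _ _ => rfl⟩
    · obtain ⟨v, hv₀, hv₁⟩ := exists_parityPart_eq w w
      refine ⟨v, ?_, ?_⟩
      · exact ⟨by rwa [hv₀], by rw [hv₁]; exact hw.1⟩
      · rw [hv₀, hv₁, CharTwo.add_self_eq_zero, zero_vecMul]
        exact ⟨fun _ _ => rfl, hoff⟩

theorem isErased_interleaveEquiv_one_iff {n : ℕ} {P : Pattern (2 ^ (n + 1))} {i : Fin (2 ^ n)} :
    IsErased (generatorMatrix (n + 1)) P (interleaveEquiv n (i, 1)) ↔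
      IsErased (generatorMatrix n) (parityPart 0 P) i ∧
        IsErased (generatorMatrix n) (parityPart 1 P) i := by
  simp only [IsErased, isLeading_interleaveEquiv_one_iff, vanishesOff_vecMul_generatorMatrix_iff]
  constructor
  · rintro ⟨w, ⟨hle₀, hlt₁, hi₁⟩, hoff₀, hoff₁⟩
    refine ⟨⟨_, ⟨fun k hk => ?_, ?_⟩, hoff₀⟩, _, ⟨hlt₁, hi₁⟩, hoff₁⟩
    · rw [Pi.add_apply, hle₀ k hk.le, hlt₁ k hk, add_zero]
    · rw [Pi.add_apply, hle₀ i le_rfl, hi₁, zero_add]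
  · rintro ⟨⟨w, hw, hoff⟩, w', hw', hoff'⟩
    obtain ⟨v, hv₀, hv₁⟩ := exists_parityPart_eq (w - w') w'
    refine ⟨v, ⟨fun k hk => ?_, by rwa [hv₁]⟩, ?_⟩
    · rw [hv₀, Pi.sub_apply, sub_eq_zero]
      rcases hk.lt_or_eq with hk | rfl
      · rw [hw.1 k hk, hw'.1 k hk]
      · rw [hw.2, hw'.2]
    · rw [hv₀, hv₁, sub_add_cancel]
      exact ⟨hoff, hoff'⟩

theorem parityPart_zero_erasurePattern {Y : Type*} {W : BDMC Y} (hW : 0 < symmetricCapacity W)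
    {n : ℕ} (P : Pattern (2 ^ (n + 1))) :
    parityPart 0 (erasurePattern W P) =
      erasurePattern W (parityPart 0 P) ⊔ erasurePattern W (parityPart 1 P) := by
  ext i
  rw [Bool.eq_iff_iff, Pi.sup_apply, Bool.max_eq_or, Bool.or_eq_true]
  simp only [parityPart, erasurePattern_eq_true_iff hW]
  exact isErased_interleaveEquiv_zero_iff

theorem parityPart_one_erasurePattern {Y : Type*} {W : BDMC Y} (hW : 0 < symmetricCapacity W)
    {n : ℕ} (P : Pattern (2 ^ (n + 1))) :
    parityPart 1 (erasurePattern W P) =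
      erasurePattern W (parityPart 0 P) ⊓ erasurePattern W (parityPart 1 P) := by
  ext i
  rw [Bool.eq_iff_iff, Pi.inf_apply, Bool.min_eq_and, Bool.and_eq_true]
  simp only [parityPart, erasurePattern_eq_true_iff hW]
  exact isErased_interleaveEquiv_one_iff

theorem sup_eq_and_inf_eq_iff_of_monotone {α : Type*} [Lattice α] {f : α → α} (hf : Monotone f)
    {a b : α} : f a ⊔ f b = a ∧ f a ⊓ f b = b ↔ f a = a ∧ f b = b ∧ b ≤ a := by
  constructor
  · rintro ⟨hsup, hinf⟩
    have hba : b ≤ a := calc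
      b = f a ⊓ f b := hinf.symm
      _ ≤ f a ⊔ f b := inf_le_sup
      _ = a := hsup
    rw [sup_eq_left.2 (hf hba)] at hsup
    rw [inf_eq_right.2 (hf hba)] at hinf
    exact ⟨hsup, hinf, hba⟩
  · rintro ⟨ha, hb, hba⟩
    rw [ha, hb]
    exact ⟨sup_eq_left.2 hba, inf_eq_right.2 hba⟩

theorem isSymmetricPattern_iff_parityPart {Y : Type*} {W : BDMC Y} (hW : 0 < symmetricCapacity W)
    {n : ℕ} (P : Pattern (2 ^ (n + 1))) :
    IsSymmetricPattern W P ↔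
      IsSymmetricPattern W (parityPart 0 P) ∧ IsSymmetricPattern W (parityPart 1 P) ∧
        parityPart 1 P ≤ parityPart 0 P := by
  simp only [IsSymmetricPattern]
  rw [ext_parityPart_iff, parityPart_zero_erasurePattern hW, parityPart_one_erasurePattern hW]
  exact sup_eq_and_inf_eq_iff_of_monotone (erasurePattern_mono hW n)

/-! ### Bit reversal -/

theorem bitReversal_finFunctionFinEquiv {n : ℕ} (d : Fin n → Fin 2) :
    bitReversal n (finFunctionFinEquiv d) = finFunctionFinEquiv (d ∘ Fin.rev) := by
  rw [bitReversal, Equiv.trans_apply, Equiv.symm_apply_apply]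
  rfl

theorem finFunctionFinEquiv_cons {n : ℕ} (b : Fin 2) (d : Fin n → Fin 2) :
    finFunctionFinEquiv (Fin.cons b d : Fin (n + 1) → Fin 2) =
      interleaveEquiv n (finFunctionFinEquiv d, b) := by
  ext
  simp only [interleaveEquiv_val, finFunctionFinEquiv_apply, Fin.sum_univ_succ, Fin.cons_zero,
    Fin.cons_succ, Fin.val_zero, Fin.val_succ, pow_zero, mul_one, Finset.mul_sum, pow_succ']
  simp only [mul_left_comm]

theorem finFunctionFinEquiv_snoc {n : ℕ} (d : Fin n → Fin 2) (b : Fin 2) :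
    finFunctionFinEquiv (Fin.snoc d b : Fin (n + 1) → Fin 2) =
      blockEquiv n (b, finFunctionFinEquiv d) := by
  ext
  simp only [blockEquiv_val, finFunctionFinEquiv_apply, Fin.sum_univ_castSucc, Fin.snoc_castSucc,
    Fin.snoc_last, Fin.val_castSucc, Fin.val_last, mul_comm]

theorem bitReversal_blockEquiv {n : ℕ} (b : Fin 2) (i : Fin (2 ^ n)) :
    bitReversal (n + 1) (blockEquiv n (b, i)) = interleaveEquiv n (bitReversal n i, b) := by
  obtain ⟨d, rfl⟩ := finFunctionFinEquiv.surjective i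
  rw [← finFunctionFinEquiv_snoc, bitReversal_finFunctionFinEquiv, bitReversal_finFunctionFinEquiv,
    ← finFunctionFinEquiv_cons, Fin.snoc_comp_rev]

theorem bitReversal_bitReversal {n : ℕ} (i : Fin (2 ^ n)) :
    bitReversal n (bitReversal n i) = i := by
  obtain ⟨d, rfl⟩ := finFunctionFinEquiv.surjective i
  rw [bitReversal_finFunctionFinEquiv, bitReversal_finFunctionFinEquiv, Function.comp_assoc,
    Fin.rev_involutive.comp_self, Function.comp_id]

theorem firstHalf_apply {n : ℕ} (A : Pattern (2 ^ (n + 1))) (i : Fin (2 ^ n)) :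
    firstHalf A i = A (blockEquiv n (0, i)) :=
  congrArg A (Fin.ext (by simp [blockEquiv_val]))

theorem secondHalf_apply {n : ℕ} (A : Pattern (2 ^ (n + 1))) (i : Fin (2 ^ n)) :
    secondHalf A i = A (blockEquiv n (1, i)) :=
  congrArg A (Fin.ext (by simp [blockEquiv_val, add_comm]))

theorem permute_firstHalf_permute_bitReversal {n : ℕ} (P : Pattern (2 ^ (n + 1))) :
    permute (bitReversal n) (firstHalf (permute (bitReversal (n + 1)) P)) = parityPart 0 P := by
  ext i
  simp only [permute, firstHalf_apply, bitReversal_blockEquiv, bitReversal_bitReversal, parityPart]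

theorem permute_secondHalf_permute_bitReversal {n : ℕ} (P : Pattern (2 ^ (n + 1))) :
    permute (bitReversal n) (secondHalf (permute (bitReversal (n + 1)) P)) = parityPart 1 P := by
  ext i
  simp only [permute, secondHalf_apply, bitReversal_blockEquiv, bitReversal_bitReversal, parityPart]

theorem bitIncluded_iff_le {N : ℕ} {A B : Pattern N} : BitIncluded A B ↔ A ≤ B :=
  sup_eq_right

theorem bitIncluded_permute_iff {N : ℕ} (φ : Equiv.Perm (Fin N)) {A B : Pattern N} :
    BitIncluded (permute φ A) (permute φ B) ↔ BitIncluded A B := by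
  simp only [bitIncluded_iff_le]
  exact φ.forall_congr_right (q := fun i => A i ≤ B i)

end PolarPuncturing

theorem mainTheorem7 {Y : Type*} (W : BDMC Y) (hW : 0 < symmetricCapacity W) (n : ℕ)
    (P Pbar : Pattern (2 ^ (n + 1))) (hPbar : Pbar = permute (bitReversal (n + 1)) P) :
    IsSymmetricPattern W P ↔
      IsSymmetricPattern W (permute (bitReversal n) (firstHalf Pbar)) ∧
      IsSymmetricPattern W (permute (bitReversal n) (secondHalf Pbar)) ∧
      BitIncluded (secondHalf Pbar) (firstHalf Pbar) := by
  subst hPbar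
  rw [← bitIncluded_permute_iff (bitReversal n), permute_firstHalf_permute_bitReversal,
    permute_secondHalf_permute_bitReversal, bitIncluded_iff_le]
  exact isSymmetricPattern_iff_parityPart hW P
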